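/- Let $N,k\ge 1$ be integers, and for $x,x_0\in\mathbb R^N$, $y\in\mathbb R^k$, $t>0$ let $$K(x,x_0,y;t)=\frac{1}{(2\pi)^{\frac{N+2k}{2}}}\int_{\mathbb R^k}\left(\frac{|\xi|}{\sinh(|\xi|t)}\right)^{\frac N2} e^{\,i\xi\cdot y-\frac{|\xi|}{2}\left((|x|^2+|x_0|^2)\coth(|\xi|t)-2\,x\cdot x_0\,\operatorname{csch}(|\xi|t)\right)}\,d\xi$$ be the heat kernel of the Grushin operator $\Delta_{\mathcal G}=\tfrac12\left(\Delta_x+|x|^2\Delta_y\right)$ on $\mathbb R^{N+k}$. The integral converges absolutely for all $x,x_0,y$ and all $t>0$, and for every $1\le q\le\infty$ there is a constant $C>0$, depending only on $N$, $k$ and $q$, such that for all $x_0\in\mathbb R^N$ and $t>0$ the function $(x,y)\mapsto K(x,x_0,y;t)$ belongs to $L^q(\mathbb R^{N+k})$ and $$\|K(\cdot,x_0,\cdot;t)\|_{L^q(\mathbb R^{N+k})}\le C\,t^{-\frac{N+2k}{2}\left(1-\frac1q\right)},$$ where $\frac1q=0$ if $q=\infty$. -/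

import Mathlib

open MeasureTheory
open scoped ENNReal

noncomputable section

namespace Grushin

/-- The integrand of the partial Fourier integral for the heat kernel of the Grushin operator
`(1/2) (Δ_x + |x|² Δ_y)` on `ℝ^N × ℝ^k`:
`(|ξ| / sinh(|ξ|t))^(N/2) · exp(i ξ·y - (|ξ|/2) ((|x|² + |x₀|²) coth(|ξ|t) - 2 x·x₀ csch(|ξ|t)))`.
For `t > 0` the only point where a denominator vanishes is `ξ = 0`. -/
def kernelIntegrand (N k : ℕ) (x x₀ : EuclideanSpace ℝ (Fin N)) (y : EuclideanSpace ℝ (Fin k))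
    (t : ℝ) (ξ : EuclideanSpace ℝ (Fin k)) : ℂ :=
  (((‖ξ‖ / Real.sinh (‖ξ‖ * t)) ^ ((N : ℝ) / 2) : ℝ) : ℂ) *
    Complex.exp (Complex.I * ((inner ℝ ξ y : ℝ) : ℂ) -
      ((‖ξ‖ / 2 * ((‖x‖ ^ 2 + ‖x₀‖ ^ 2) * (Real.cosh (‖ξ‖ * t) / Real.sinh (‖ξ‖ * t)) -
        2 * inner ℝ x x₀ * (1 / Real.sinh (‖ξ‖ * t))) : ℝ) : ℂ))

/-- The Grushin heat kernel
`K(x, x₀, y; t) = (2π)^(-(N+2k)/2) ∫_{ℝ^k} kernelIntegrand N k x x₀ y t ξ dξ`. -/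
def heatKernel (N k : ℕ) (x x₀ : EuclideanSpace ℝ (Fin N)) (y : EuclideanSpace ℝ (Fin k))
    (t : ℝ) : ℂ :=
  ((1 / (2 * Real.pi) ^ (((N : ℝ) + 2 * (k : ℝ)) / 2) : ℝ) : ℂ) *
    ∫ ξ : EuclideanSpace ℝ (Fin k), kernelIntegrand N k x x₀ y t ξ

end Grushin

end

namespace Grushin

open Real Filter Topology

/-! ### Functions whose multiplication preserves nonnegativity of cosine transforms. -/

section Multiplier

variable {V : Type*} [NormedAddCommGroup V] [InnerProductSpace ℝ V] [FiniteDimensional ℝ V]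
  [MeasurableSpace V] [BorelSpace V]

/-! The bound interpolates between `q = ∞` and `q = 1`. Bounding the integrand by its modulus
`kernelWeight`, at most `(|ξ| / sinh(|ξ|t))^(N/2)`, and rescaling `ξ` by `t` gives the sup bound `C
t^(-(N+2k)/2)`.

For `q = 1` the point is that `K ≥ 0`, so its `y`-integral is controlled by the sup of the weight,
which is a Gaussian in `x - x₀`; the constants make the total mass at most 1. Nonnegativity is
positive definiteness of the weight in `ξ`. Half-angle formulas (`kernelWeight_eq`) split it into a
power of `|ξ| / sinh` and exponentials of `-|ξ| coth` and `-|ξ| tanh`. Euler's product and the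
partial fractions of `coth` and `tanh` make these limits of products of `(1 + κ|ξ|²)^(-a)` and
`exp(-c(1 - 1/(1 + κ|ξ|²)))`, which are built from Gaussians. `PosMultiplier` encodes positive
definiteness by its action on integrable functions, so that products are compositions and
non-integrable factors are allowed. -/

theorem integrable_mul_cos {g : V → ℝ} (hg : Integrable g) (y : V) :
    Integrable fun ξ => g ξ * cos (inner ℝ ξ y) := by
  refine hg.mul_bdd (c := 1) (by fun_prop) (Eventually.of_forall fun ξ => ?_)
  simpa using abs_cos_le_one _

/-- A bounded measurable function is a positive multiplier if multiplication by it preserves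
the integrable functions whose cosine transform is nonnegative. -/
structure PosMultiplier (f : V → ℝ) : Prop where
  measurable : Measurable f
  bounded : ∃ C : ℝ, ∀ ξ, |f ξ| ≤ C
  pos : ∀ g : V → ℝ, Integrable g → (∀ y : V, 0 ≤ ∫ ξ, g ξ * cos (inner ℝ ξ y)) →
    ∀ y : V, 0 ≤ ∫ ξ, f ξ * g ξ * cos (inner ℝ ξ y)

namespace PosMultiplier

theorem congr {f g : V → ℝ} (hf : PosMultiplier f) (h : ∀ ξ, g ξ = f ξ) : PosMultiplier g :=
  funext h ▸ hf

theorem integrable_mul {f g : V → ℝ} (hf : PosMultiplier f) (hg : Integrable g) :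
    Integrable fun ξ => f ξ * g ξ := by
  obtain ⟨C, hC⟩ := hf.bounded
  exact hg.bdd_mul hf.measurable.aestronglyMeasurable (Eventually.of_forall hC)

theorem mul {f g : V → ℝ} (hf : PosMultiplier f) (hg : PosMultiplier g) :
    PosMultiplier fun ξ => f ξ * g ξ := by
  refine ⟨hf.measurable.mul hg.measurable, ?_, fun h hh hp y => ?_⟩
  · obtain ⟨C, hC⟩ := hf.bounded
    obtain ⟨D, hD⟩ := hg.bounded
    refine ⟨C * D, fun ξ => ?_⟩
    rw [abs_mul]
    exact mul_le_mul (hC ξ) (hD ξ) (abs_nonneg _) ((abs_nonneg _).trans (hC ξ))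
  · have := hf.pos _ (hg.integrable_mul hh) (hg.pos h hh hp) y
    simpa only [mul_assoc] using this

theorem add {f g : V → ℝ} (hf : PosMultiplier f) (hg : PosMultiplier g) :
    PosMultiplier fun ξ => f ξ + g ξ := by
  refine ⟨hf.measurable.add hg.measurable, ?_, fun h hh hp y => ?_⟩
  · obtain ⟨C, hC⟩ := hf.bounded
    obtain ⟨D, hD⟩ := hg.bounded
    exact ⟨C + D, fun ξ => (abs_add_le _ _).trans (add_le_add (hC ξ) (hD ξ))⟩
  · simp only [add_mul]
    rw [integral_add (integrable_mul_cos (hf.integrable_mul hh) y)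
      (integrable_mul_cos (hg.integrable_mul hh) y)]
    exact add_nonneg (hf.pos h hh hp y) (hg.pos h hh hp y)

theorem const {c : ℝ} (hc : 0 ≤ c) : PosMultiplier fun _ : V => c := by
  refine ⟨measurable_const, ⟨|c|, fun _ => le_rfl⟩, fun h hh hp y => ?_⟩
  simp only [mul_assoc]
  rw [integral_const_mul]
  exact mul_nonneg hc (hp y)

theorem pow {f : V → ℝ} (hf : PosMultiplier f) (n : ℕ) : PosMultiplier fun ξ => f ξ ^ n := by
  induction n with
  | zero => simpa using const zero_le_one
  | succ n ih => simpa only [pow_succ] using ih.mul hf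

theorem prod {f : ℕ → V → ℝ} (hf : ∀ i, PosMultiplier (f i)) (n : ℕ) :
    PosMultiplier fun ξ => ∏ i ∈ Finset.range n, f i ξ := by
  induction n with
  | zero => simpa using const zero_le_one
  | succ n ih => simpa only [Finset.prod_range_succ] using ih.mul (hf n)

theorem sum {f : ℕ → V → ℝ} (hf : ∀ i, PosMultiplier (f i)) (n : ℕ) :
    PosMultiplier fun ξ => ∑ i ∈ Finset.range n, f i ξ := by
  induction n with
  | zero => simpa using const le_rfl
  | succ n ih => simpa only [Finset.sum_range_succ] using ih.add (hf n)

/-- Dominated convergence. Almost everywhere convergence matters: the quotients by `sinh` take the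
value 0 at `ξ = 0`, not their limit. -/
theorem of_tendsto {F : ℕ → V → ℝ} {f : V → ℝ} {C : ℝ} (hF : ∀ n, PosMultiplier (F n))
    (hC : ∀ n ξ, |F n ξ| ≤ C) (hm : Measurable f) (hfC : ∀ ξ, |f ξ| ≤ C)
    (hlim : ∀ᵐ ξ, Tendsto (fun n => F n ξ) atTop (𝓝 (f ξ))) : PosMultiplier f := by
  refine ⟨hm, ⟨C, hfC⟩, fun g hg hp y => ?_⟩
  refine ge_of_tendsto' (tendsto_integral_of_dominated_convergence (fun ξ => C * |g ξ|)
    (F := fun n ξ => F n ξ * g ξ * cos (inner ℝ ξ y)) (fun n => ?_) (hg.abs.const_mul C)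
    (fun n => Eventually.of_forall fun ξ => ?_) ?_) fun n => (hF n).pos g hg hp y
  · exact (integrable_mul_cos ((hF n).integrable_mul hg) y).aestronglyMeasurable
  · rw [norm_eq_abs, abs_mul, abs_mul]
    calc |F n ξ| * |g ξ| * |cos (inner ℝ ξ y)| ≤ |F n ξ| * |g ξ| * 1 := by
          gcongr; exact abs_cos_le_one _
      _ ≤ C * |g ξ| := by rw [mul_one]; gcongr; exact hC n ξ
  · filter_upwards [hlim] with ξ hξ
    exact (hξ.mul_const _).mul_const _

theorem exp {f : V → ℝ} (hf : PosMultiplier f) : PosMultiplier fun ξ => rexp (f ξ) := by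
  obtain ⟨C, hC⟩ := hf.bounded
  refine of_tendsto (V := V) (C := rexp C) (F := fun n ξ => ∑ i ∈ Finset.range n, (i.factorial : ℝ)⁻¹ * f ξ ^ i)
    (fun n => sum (fun i => (const (by positivity)).mul (hf.pow i)) n) (fun n ξ => ?_)
    hf.measurable.exp (fun ξ => ?_) (Eventually.of_forall fun ξ => ?_)
  · refine (Finset.abs_sum_le_sum_abs _ _).trans ?_
    refine le_trans ?_ (sum_le_exp_of_nonneg ((abs_nonneg _).trans (hC ξ)) n)
    refine Finset.sum_le_sum fun i _ => ?_
    rw [abs_mul, abs_pow, abs_of_nonneg (by positivity), div_eq_inv_mul]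
    gcongr
    exact hC ξ
  · rw [abs_of_nonneg (exp_nonneg _)]
    exact exp_le_exp.2 ((le_abs_self _).trans (hC ξ))
  · have := (NormedSpace.expSeries_div_hasSum_exp (𝔸 := ℝ) (f ξ)).tendsto_sum_nat
    simpa only [← Real.exp_eq_exp_ℝ, div_eq_inv_mul] using this

theorem integral {Ω : Type*} [MeasurableSpace Ω] {μ : Measure Ω} [SFinite μ] {F : Ω → V → ℝ}
    (hm : Measurable (Function.uncurry F)) {C : Ω → ℝ} (hC : Integrable C μ)
    (hb : ∀ᵐ ω ∂μ, ∀ ξ, |F ω ξ| ≤ C ω) (hF : ∀ᵐ ω ∂μ, PosMultiplier (F ω)) :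
    PosMultiplier fun ξ => ∫ ω, F ω ξ ∂μ := by
  have hm' : Measurable (Function.uncurry fun ξ ω => F ω ξ) := hm.comp measurable_swap
  refine ⟨(StronglyMeasurable.integral_prod_right (ν := μ) hm'.stronglyMeasurable).measurable, ⟨∫ ω, C ω ∂μ, fun ξ => ?_⟩,
    fun g hg hp y => ?_⟩
  · rw [← norm_eq_abs]
    refine norm_integral_le_of_norm_le hC ?_
    filter_upwards [hb] with ω hω using hω ξ
  · have hint : Integrable (Function.uncurry fun ξ ω => F ω ξ * g ξ * cos (inner ℝ ξ y))
        (volume.prod μ) := by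
      refine (hg.abs.mul_prod hC).mono' ?_ ?_
      · exact (hm'.aestronglyMeasurable.mul hg.aestronglyMeasurable.comp_fst).mul
          (by fun_prop)
      · filter_upwards [Measure.quasiMeasurePreserving_snd.ae hb] with p hp
        rw [Function.uncurry, norm_eq_abs, abs_mul, abs_mul, mul_comm |g p.1|]
        calc _ ≤ |F p.2 p.1| * |g p.1| * 1 := by gcongr; exact abs_cos_le_one _
          _ ≤ _ := by rw [mul_one]; gcongr; exact hp _
    simp only [← integral_mul_const]
    rw [integral_integral_swap hint]
    refine integral_nonneg_of_ae ?_
    filter_upwards [hF] with ω hω using hω.pos g hg hp y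

/-- By product-to-sum, multiplying by this cosine averages the transform over the translates by `η`
and `-η`. -/
theorem cos_inner (η : V) : PosMultiplier fun ξ : V => cos (inner ℝ ξ η) := by
  refine ⟨by fun_prop, ⟨1, fun _ => abs_cos_le_one _⟩, fun g hg hp y => ?_⟩
  have : ∀ ξ, cos (inner ℝ ξ η) * g ξ * cos (inner ℝ ξ y) =
      1 / 2 * (g ξ * cos (inner ℝ ξ (y + η))) + 1 / 2 * (g ξ * cos (inner ℝ ξ (y - η))) := by
    intro ξ
    rw [inner_add_right, inner_sub_right, cos_add, cos_sub]
    ring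
  simp only [this]
  rw [integral_add ((integrable_mul_cos hg _).const_mul _) ((integrable_mul_cos hg _).const_mul _),
    integral_const_mul, integral_const_mul]
  have h1 := hp (y + η)
  have h2 := hp (y - η)
  positivity

end PosMultiplier

theorem integrable_gaussian {b : ℝ} (hb : 0 < b) : Integrable fun v : V => rexp (-b * ‖v‖ ^ 2) := by
  have := (GaussianFourier.integrable_cexp_neg_mul_sq_norm_add (V := V) (b := (b : ℂ))
    (by simpa using hb) 0 0).re
  refine this.congr (Eventually.of_forall fun v => ?_)
  simp only [zero_mul, add_zero]
  rw [show (-(b : ℂ) * (‖v‖ : ℂ) ^ 2) = ((-b * ‖v‖ ^ 2 : ℝ) : ℂ) by push_cast; ring,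
    ← Complex.ofReal_exp]
  rfl

theorem integral_gaussian_mul_cos {b : ℝ} (hb : 0 < b) (w : V) :
    ∫ v : V, rexp (-b * ‖v‖ ^ 2) * cos (inner ℝ v w) =
      (π / b) ^ (Module.finrank ℝ V / 2 : ℝ) * rexp (-(1 / (4 * b)) * ‖w‖ ^ 2) := by
  have hb' : 0 < (b : ℂ).re := by simpa using hb
  have h := congrArg Complex.re
    (GaussianFourier.integral_cexp_neg_mul_sq_norm_add hb' Complex.I w)
  have hi := GaussianFourier.integrable_cexp_neg_mul_sq_norm_add hb' Complex.I w
  rw [← Complex.reCLM_apply, ← ContinuousLinearMap.integral_comp_comm _ hi] at h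
  have e1 : ((π : ℂ) / b) ^ (Module.finrank ℝ V / 2 : ℂ) *
      Complex.exp (Complex.I ^ 2 * ‖w‖ ^ 2 / (4 * b)) =
      (((π / b) ^ (Module.finrank ℝ V / 2 : ℝ) * rexp (-(1 / (4 * b)) * ‖w‖ ^ 2) : ℝ) : ℂ) := by
    rw [Complex.ofReal_mul, Complex.ofReal_cpow (by positivity), Complex.ofReal_exp]
    congr 1
    · push_cast; rfl
    · congr 1
      rw [Complex.I_sq]; push_cast; ring
  rw [e1, Complex.ofReal_re] at h
  rw [← h]
  refine integral_congr_ae (Eventually.of_forall fun v => ?_)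
  simp only [Complex.reCLM_apply]
  rw [Complex.exp_re]
  have hsq : ((‖v‖ : ℂ) ^ 2) = ((‖v‖ ^ 2 : ℝ) : ℂ) := by push_cast; ring
  rw [hsq]
  simp [-Complex.ofReal_pow, real_inner_comm]

namespace PosMultiplier

theorem gaussian {s : ℝ} (hs : 0 < s) : PosMultiplier fun ξ : V => rexp (-s * ‖ξ‖ ^ 2) := by
  -- A Gaussian is an average of cosines under a Gaussian weight; this parameter makes the
  -- transformed exponent equal to `s`.
  have hb : 0 < 1 / (4 * s) := by positivity
  have key := integral (V := V) (μ := (volume : Measure V))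
    (F := fun η ξ => rexp (-(1 / (4 * s)) * ‖η‖ ^ 2) * cos (inner ℝ η ξ))
    (C := fun η => rexp (-(1 / (4 * s)) * ‖η‖ ^ 2)) (by unfold Function.uncurry; fun_prop)
    (integrable_gaussian hb) (Eventually.of_forall fun η ξ => ?_)
    (Eventually.of_forall fun η => ?_)
  · have hA : 0 < (π / (1 / (4 * s))) ^ (Module.finrank ℝ V / 2 : ℝ) := by positivity
    have := (const (V := V) (inv_nonneg.2 hA.le)).mul key
    refine this.congr fun ξ => ?_
    rw [integral_gaussian_mul_cos hb, inv_mul_cancel_left₀ hA.ne']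
    congr 2
    field_simp
  · rw [abs_mul, abs_of_nonneg (exp_nonneg _)]
    exact mul_le_of_le_one_right (exp_nonneg _) (abs_cos_le_one _)
  · refine (const (exp_nonneg _)).mul ?_
    simpa only [real_inner_comm] using cos_inner η

/-- The Gamma integral writes this as a positive average of Gaussians, for real `a`, as the exponent
`N/2` requires. -/
theorem one_div_one_add_rpow {κ a : ℝ} (hκ : 0 < κ) (ha : 0 < a) :
    PosMultiplier fun ξ : V => (1 / (1 + κ * ‖ξ‖ ^ 2)) ^ a := by
  have hC : Integrable (fun s : ℝ => s ^ (a - 1) * rexp (-(1 * s))) (volume.restrict (Set.Ioi 0)) := by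
    have := Real.GammaIntegral_convergent ha
    refine this.congr (Eventually.of_forall fun s => ?_)
    simp only [one_mul]; ring
  have key := integral (V := V) (μ := (volume.restrict (Set.Ioi (0 : ℝ))))
    (F := fun s ξ => s ^ (a - 1) * rexp (-((1 + κ * ‖ξ‖ ^ 2) * s)))
    (by unfold Function.uncurry; fun_prop) hC
    ((ae_restrict_iff' measurableSet_Ioi).2 (Eventually.of_forall fun s hs ξ => ?_))
    ((ae_restrict_iff' measurableSet_Ioi).2 (Eventually.of_forall fun s hs => ?_))
  · have := (const (V := V) (inv_nonneg.2 (Gamma_pos_of_pos ha).le)).mul key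
    refine this.congr fun ξ => ?_
    rw [integral_rpow_mul_exp_neg_mul_Ioi ha (by positivity)]
    field_simp [(Gamma_pos_of_pos ha).ne']
  · have hs : 0 < s := hs
    rw [abs_of_nonneg (by positivity)]
    gcongr
    nlinarith [mul_nonneg hκ.le (sq_nonneg ‖ξ‖)]
  · have hs : 0 < s := hs
    have h1 : 0 ≤ s ^ (a - 1) * rexp (-s) := by positivity
    have := (const (V := V) h1).mul (gaussian (V := V) (mul_pos hκ hs))
    refine this.congr fun ξ => ?_
    rw [mul_assoc, ← Real.exp_add]
    ring_nf

/-- Factor out `e^(-c)`; what remains is the exponential of a positive multiplier. -/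
theorem exp_neg_one_sub {κ c : ℝ} (hκ : 0 < κ) (hc : 0 ≤ c) :
    PosMultiplier fun ξ : V => rexp (-(c * (1 - 1 / (1 + κ * ‖ξ‖ ^ 2)))) := by
  have := (const (V := V) (exp_nonneg (-c))).mul
    ((const hc).mul (one_div_one_add_rpow (V := V) hκ one_pos)).exp
  refine this.congr fun ξ => ?_
  rw [← Real.exp_add, rpow_one]
  ring_nf

end PosMultiplier

end Multiplier

/-! ### Euler's product for `sinh` and partial fractions of `coth` and `tanh`. -/

section Series

theorem tendsto_prod_sinh {u : ℝ} (hu : u ≠ 0) :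
    Tendsto (fun n : ℕ => ∏ j ∈ Finset.range n, (1 + u ^ 2 / (π * (j + 1)) ^ 2)) atTop
      (𝓝 (sinh u / u)) := by
  have hx : ((u / π : ℝ) : ℂ) * Complex.I ≠ 0 := by
    simp [hu, pi_ne_zero]
  have h := (Complex.continuous_re.tendsto _).comp (tendsto_euler_sin_prod' hx)
  have hπ : (π : ℂ) ≠ 0 := by exact_mod_cast pi_ne_zero
  have e : (π : ℂ) * (((u / π : ℝ) : ℂ) * Complex.I) = u * Complex.I := by
    push_cast; field_simp
  have e2 : Complex.sin (u * Complex.I) / (u * Complex.I) = ((sinh u / u : ℝ) : ℂ) := by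
    rw [Complex.sin_mul_I, mul_div_mul_right _ _ Complex.I_ne_zero]
    push_cast; rfl
  rw [e, e2, Complex.ofReal_re] at h
  refine h.congr fun n => ?_
  rw [Function.comp_apply, ← Complex.ofReal_re (∏ j ∈ Finset.range n, _)]
  congr 1
  push_cast
  refine Finset.prod_congr rfl fun j _ => ?_
  have : ((j : ℂ) + 1) ≠ 0 := Nat.cast_add_one_ne_zero j
  rw [sineTerm, mul_pow, Complex.I_sq]
  field_simp

/-- The cotangent expansion at `iu/π`, with terms shaped to match `exp_neg_one_sub`. -/
theorem tendsto_sum_coth {u : ℝ} (hu : u ≠ 0) :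
    Tendsto (fun n : ℕ => ∑ j ∈ Finset.range n, 2 * (1 - 1 / (1 + u ^ 2 / (π * (j + 1)) ^ 2)))
      atTop (𝓝 (u * (cosh u / sinh u) - 1)) := by
  have hπ : (π : ℂ) ≠ 0 := by exact_mod_cast pi_ne_zero
  have hu' : (u : ℂ) ≠ 0 := by exact_mod_cast hu
  have hx : ((u / π : ℝ) : ℂ) * Complex.I ∈ Complex.integerComplement := by
    rintro ⟨n, hn⟩
    have := congrArg Complex.im hn
    rw [Complex.intCast_im, Complex.im_ofReal_mul, Complex.I_im, mul_one] at this
    exact div_ne_zero hu pi_ne_zero this.symm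
  have h := (Complex.continuous_re.tendsto _).comp
    ((tendsto_logDeriv_euler_cot_sub hx).const_mul (((u / π : ℝ) : ℂ) * Complex.I))
  have e : (π : ℂ) * (((u / π : ℝ) : ℂ) * Complex.I) = u * Complex.I := by
    push_cast; field_simp
  have hsh : Complex.sinh u ≠ 0 := by
    rw [← Complex.ofReal_sinh]
    exact_mod_cast sinh_ne_zero.2 hu
  have e2 : ((u / π : ℝ) : ℂ) * Complex.I *
      (π * Complex.cot (π * (((u / π : ℝ) : ℂ) * Complex.I)) - 1 / (((u / π : ℝ) : ℂ) * Complex.I))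
      = ((u * (cosh u / sinh u) - 1 : ℝ) : ℂ) := by
    rw [e, Complex.cot, Complex.sin_mul_I, Complex.cos_mul_I]
    push_cast
    have := Complex.I_ne_zero
    field_simp
  rw [e2, Complex.ofReal_re] at h
  refine h.congr fun n => ?_
  rw [Function.comp_apply, ← Complex.ofReal_re (∑ j ∈ Finset.range n, _), Finset.mul_sum]
  congr 1
  rw [Complex.ofReal_sum]
  refine Finset.sum_congr rfl fun j _ => ?_
  have hj : ((j : ℂ) + 1) ≠ 0 := Nat.cast_add_one_ne_zero j
  have h3 : (π : ℂ) ^ 2 * (j + 1) ^ 2 + u ^ 2 ≠ 0 := by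
    have : 0 < π ^ 2 * ((j : ℝ) + 1) ^ 2 + u ^ 2 := by positivity
    exact_mod_cast this.ne'
  have e4 : (1 : ℂ) + (u : ℂ) ^ 2 / (π * (j + 1)) ^ 2 =
      (π ^ 2 * (j + 1) ^ 2 + u ^ 2) / (π * (j + 1)) ^ 2 := by
    field_simp
  rw [cotTerm_identity hx]
  have e5 : (((u / π : ℝ) : ℂ) * Complex.I + (j + 1)) * (((u / π : ℝ) : ℂ) * Complex.I - (j + 1)) =
      -((π ^ 2 * (j + 1) ^ 2 + u ^ 2) / π ^ 2) := by
    rw [← sq_sub_sq, mul_pow, Complex.I_sq]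
    push_cast
    field_simp
    ring
  rw [e5]
  push_cast
  rw [e4]
  field_simp
  rw [Complex.I_sq]
  ring

theorem mul_tanh_eq {u : ℝ} (hu : u ≠ 0) :
    2 * u * (cosh (2 * u) / sinh (2 * u)) - u * (cosh u / sinh u) = u * (sinh u / cosh u) := by
  have hs := sinh_ne_zero.2 hu
  have hc := (cosh_pos u).ne'
  rw [sinh_two_mul, cosh_two_mul]
  field_simp
  ring

/-- By `mul_tanh_eq`, subtract the `coth` series at `u` from the one at `2u`: its even poles cancel
and the odd ones remain. Hence `2n` terms are taken against `n`. -/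
theorem tendsto_sum_tanh {u : ℝ} (hu : u ≠ 0) :
    Tendsto (fun n : ℕ => ∑ j ∈ Finset.range n,
      2 * (1 - 1 / (1 + (2 * u) ^ 2 / (π * (2 * j + 1)) ^ 2)))
      atTop (𝓝 (u * (sinh u / cosh u))) := by
  have h1 := (tendsto_sum_coth (mul_ne_zero two_ne_zero hu)).comp
    (tendsto_id.const_mul_atTop' (zero_lt_two : 0 < 2))
  have h := h1.sub (tendsto_sum_coth hu)
  rw [sub_sub_sub_cancel_right, mul_tanh_eq hu] at h
  refine h.congr fun n => ?_
  simp only [Function.comp_apply, id]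
  induction n with
  | zero => simp
  | succ n ih =>
    rw [show 2 * (n + 1) = 2 * n + 1 + 1 by ring, Finset.sum_range_succ, Finset.sum_range_succ,
      Finset.sum_range_succ, Finset.sum_range_succ, ← ih]
    have : (2 * u) ^ 2 / (π * (((2 * n + 1 : ℕ) : ℝ) + 1)) ^ 2 = u ^ 2 / (π * (n + 1)) ^ 2 := by
      push_cast
      field_simp
      ring
    rw [this]
    push_cast
    ring

end Series

/-! ### Positivity of the three factors of the weight. -/

section KernelFactors

variable {V : Type*} [NormedAddCommGroup V] [InnerProductSpace ℝ V] [FiniteDimensional ℝ V]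
  [MeasurableSpace V] [BorelSpace V]

theorem div_sinh_nonneg (u : ℝ) : 0 ≤ u / sinh u := by
  rcases le_total 0 u with h | h
  · exact div_nonneg h (sinh_nonneg_iff.2 h)
  · exact div_nonneg_of_nonpos h (sinh_nonpos_iff.2 h)

theorem div_sinh_le_one {u : ℝ} (hu : 0 ≤ u) : u / sinh u ≤ 1 :=
  div_le_one_of_le₀ (self_le_sinh_iff.2 hu) (sinh_nonneg_iff.2 hu)

namespace PosMultiplier

variable [Nontrivial V]

theorem div_sinh_rpow {t a : ℝ} (ht : 0 < t) (ha : 0 < a) :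
    PosMultiplier fun ξ : V => (‖ξ‖ / sinh (‖ξ‖ * t)) ^ a := by
  have key : PosMultiplier fun ξ : V => (‖ξ‖ * t / sinh (‖ξ‖ * t)) ^ a := by
    refine of_tendsto (V := V) (C := 1) (F := fun n ξ => ∏ j ∈ Finset.range n,
      (1 / (1 + t ^ 2 / (π * (j + 1)) ^ 2 * ‖ξ‖ ^ 2)) ^ a)
      (fun n => prod (fun j => one_div_one_add_rpow (by positivity) ha) n)
      (fun n ξ => ?_) (by fun_prop) (fun ξ => ?_) ?_
    · rw [abs_of_nonneg (by positivity)]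
      refine Finset.prod_le_one (fun _ _ => by positivity) fun j _ => ?_
      refine rpow_le_one (by positivity) ?_ ha.le
      rw [div_le_one (by positivity)]
      linarith [show 0 ≤ t ^ 2 / (π * ((j : ℝ) + 1)) ^ 2 * ‖ξ‖ ^ 2 by positivity]
    · have h0 := div_sinh_nonneg (‖ξ‖ * t)
      rw [abs_of_nonneg (rpow_nonneg h0 _)]
      exact rpow_le_one h0 (div_sinh_le_one (by positivity)) ha.le
    · filter_upwards [Measure.ae_ne volume (0 : V)] with ξ hξ
      have hu : ‖ξ‖ * t ≠ 0 := mul_ne_zero (norm_ne_zero_iff.2 hξ) ht.ne'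
      have h := ((tendsto_prod_sinh hu).inv₀ (div_ne_zero (sinh_ne_zero.2 hu) hu)).rpow_const
        (p := a) (Or.inr ha.le)
      rw [inv_div] at h
      refine h.congr fun n => ?_
      rw [Real.finsetProd_rpow _ _ (fun _ _ => by positivity), ← Finset.prod_inv_distrib]
      congr 1
      refine Finset.prod_congr rfl fun j _ => ?_
      rw [one_div]
      congr 2
      ring
  have := (const (V := V) (inv_nonneg.2 (rpow_nonneg ht.le a))).mul key
  refine this.congr fun ξ => ?_
  rw [mul_div_right_comm, mul_rpow (div_nonneg (norm_nonneg _)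
    (sinh_nonneg_iff.2 (by positivity))) ht.le, mul_left_comm,
    inv_mul_cancel₀ (rpow_pos_of_pos ht a).ne', mul_one]

/-- The lower bound is `-1` rather than 0 because `u coth u - 1` evaluates to `-1` at `u = 0` under
division by zero. -/
theorem exp_neg_of_tendsto_sum {κ : ℕ → ℝ} (hκ : ∀ j, 0 < κ j) {c : ℝ} (hc : 0 ≤ c) {f : V → ℝ}
    (hm : Measurable f) (hf : ∀ ξ, -1 ≤ f ξ)
    (h : ∀ ξ ≠ 0, Tendsto (fun n : ℕ => ∑ j ∈ Finset.range n,
      2 * (1 - 1 / (1 + κ j * ‖ξ‖ ^ 2))) atTop (𝓝 (f ξ))) :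
    PosMultiplier fun ξ => rexp (-(c * f ξ)) := by
  refine of_tendsto (V := V) (C := rexp c) (F := fun n ξ => ∏ j ∈ Finset.range n,
      rexp (-(c * 2 * (1 - 1 / (1 + κ j * ‖ξ‖ ^ 2)))))
      (fun n => prod (fun j => exp_neg_one_sub (hκ j) (by positivity)) n)
      (fun n ξ => ?_) (by fun_prop) (fun ξ => ?_) ?_
  · rw [abs_of_nonneg (by positivity)]
    refine (Finset.prod_le_one (fun _ _ => by positivity) fun j _ => ?_).trans (one_le_exp hc)
    rw [exp_le_one_iff, neg_nonpos]
    refine mul_nonneg (by positivity) (sub_nonneg.2 ?_)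
    have := hκ j
    rw [div_le_one (by positivity)]
    linarith [show 0 ≤ κ j * ‖ξ‖ ^ 2 by positivity]
  · rw [abs_of_nonneg (exp_nonneg _), exp_le_exp]
    nlinarith [hf ξ]
  · filter_upwards [Measure.ae_ne volume (0 : V)] with ξ hξ
    refine (((h ξ hξ).const_mul c).neg.rexp).congr fun n => ?_
    rw [← Real.exp_sum, Finset.sum_neg_distrib, Finset.mul_sum]
    simp only [mul_assoc]

theorem exp_neg_coth {c τ : ℝ} (hc : 0 ≤ c) (hτ : 0 < τ) :
    PosMultiplier fun ξ : V => rexp (-(c * (‖ξ‖ * (cosh (‖ξ‖ * τ) / sinh (‖ξ‖ * τ))))) := by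
  have key := exp_neg_of_tendsto_sum (V := V) (κ := fun j => τ ^ 2 / (π * (j + 1)) ^ 2)
    (fun j => by positivity) (div_nonneg hc hτ.le)
    (f := fun ξ => ‖ξ‖ * τ * (cosh (‖ξ‖ * τ) / sinh (‖ξ‖ * τ)) - 1) (by fun_prop)
    (fun ξ => ?_) (fun ξ hξ => ?_)
  · refine ((const (V := V) (exp_nonneg (-(c / τ)))).mul key).congr fun ξ => ?_
    rw [← Real.exp_add]
    congr 1
    field_simp
    ring
  · have h1 : 0 ≤ ‖ξ‖ * τ := by positivity
    have h2 : 0 ≤ sinh (‖ξ‖ * τ) := sinh_nonneg_iff.2 h1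
    have h3 := cosh_pos (‖ξ‖ * τ)
    have : 0 ≤ ‖ξ‖ * τ * (cosh (‖ξ‖ * τ) / sinh (‖ξ‖ * τ)) := by positivity
    linarith
  · have hu : ‖ξ‖ * τ ≠ 0 := mul_ne_zero (norm_ne_zero_iff.2 hξ) hτ.ne'
    refine (tendsto_sum_coth hu).congr fun n => Finset.sum_congr rfl fun j _ => ?_
    ring_nf

theorem exp_neg_tanh {c τ : ℝ} (hc : 0 ≤ c) (hτ : 0 < τ) :
    PosMultiplier fun ξ : V => rexp (-(c * (‖ξ‖ * (sinh (‖ξ‖ * τ) / cosh (‖ξ‖ * τ))))) := by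
  have key := exp_neg_of_tendsto_sum (V := V) (κ := fun j => (2 * τ) ^ 2 / (π * (2 * j + 1)) ^ 2)
    (fun j => by positivity) (div_nonneg hc hτ.le)
    (f := fun ξ => ‖ξ‖ * τ * (sinh (‖ξ‖ * τ) / cosh (‖ξ‖ * τ))) ?_
    (fun ξ => ?_) (fun ξ hξ => ?_)
  · refine key.congr fun ξ => ?_
    congr 1
    field_simp
  · fun_prop
  · have h1 : 0 ≤ ‖ξ‖ * τ := by positivity
    have h2 : 0 ≤ sinh (‖ξ‖ * τ) := sinh_nonneg_iff.2 h1
    have h3 := cosh_pos (‖ξ‖ * τ)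
    have : 0 ≤ ‖ξ‖ * τ * (sinh (‖ξ‖ * τ) / cosh (‖ξ‖ * τ)) := by positivity
    linarith
  · have hu : ‖ξ‖ * τ ≠ 0 := mul_ne_zero (norm_ne_zero_iff.2 hξ) hτ.ne'
    refine (tendsto_sum_tanh hu).congr fun n => Finset.sum_congr rfl fun j _ => ?_
    ring_nf

end PosMultiplier

end KernelFactors

/-! ### Nonnegativity and total mass of cosine transforms. -/

section CosTransform

theorem tendsto_gaussian_one {E : Type*} [SeminormedAddCommGroup E] (v : E) :
    Tendsto (fun n : ℕ => rexp (-(1 / ((n : ℝ) + 1)) * ‖v‖ ^ 2)) atTop (𝓝 1) := by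
  simpa using ((tendsto_one_div_add_atTop_nhds_zero_nat (𝕜 := ℝ)).neg.mul_const (‖v‖ ^ 2)).rexp

variable {V : Type*} [NormedAddCommGroup V] [InnerProductSpace ℝ V] [FiniteDimensional ℝ V]
  [MeasurableSpace V] [BorelSpace V]

/-- Test `f` on Gaussians, whose transforms are positive, and let them widen to 1. -/
theorem PosMultiplier.cosTransform_nonneg {f : V → ℝ} (hf : PosMultiplier f) (hi : Integrable f)
    (y : V) : 0 ≤ ∫ ξ, f ξ * cos (inner ℝ ξ y) := by
  have hn : ∀ n : ℕ, (0 : ℝ) < 1 / ((n : ℝ) + 1) := fun n => by positivity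
  refine ge_of_tendsto' (tendsto_integral_of_dominated_convergence (fun ξ => |f ξ|)
    (F := fun (n : ℕ) ξ => f ξ * rexp (-(1 / ((n : ℝ) + 1)) * ‖ξ‖ ^ 2) * cos (inner ℝ ξ y))
    (fun n => ?_) hi.abs (fun n => Eventually.of_forall fun ξ => ?_)
    (Eventually.of_forall fun ξ => ?_)) fun n => hf.pos _ (integrable_gaussian (hn n))
      (fun y => ?_) y
  · exact (integrable_mul_cos (hf.integrable_mul (integrable_gaussian (hn n))) y).aestronglyMeasurable
  · rw [norm_eq_abs, abs_mul, abs_mul, mul_assoc]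
    refine mul_le_of_le_one_right (abs_nonneg _) (mul_le_one₀ ?_ (abs_nonneg _) (abs_cos_le_one _))
    rw [abs_of_nonneg (exp_nonneg _), exp_le_one_iff]
    nlinarith [mul_nonneg (hn n).le (sq_nonneg ‖ξ‖)]
  · simpa using ((tendsto_gaussian_one ξ).const_mul (f ξ)).mul_const (cos (inner ℝ ξ y))
  · rw [integral_gaussian_mul_cos (hn n)]
    positivity

/-- Fubini moves the Gaussian onto `f`, where it becomes a kernel of mass `(2π)^dim`. Only a sup
bound on `f` enters, not continuity at 0. -/
theorem integral_gaussian_mul_cosTransform_le {f : V → ℝ} (hi : Integrable f) {B : ℝ}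
    (hB : ∀ ξ, f ξ ≤ B) {ε : ℝ} (hε : 0 < ε) :
    ∫ y : V, rexp (-ε * ‖y‖ ^ 2) * ∫ ξ, f ξ * cos (inner ℝ ξ y) ≤
      B * (2 * π) ^ Module.finrank ℝ V := by
  have hint : Integrable (Function.uncurry fun y ξ : V =>
      rexp (-ε * ‖y‖ ^ 2) * (f ξ * cos (inner ℝ ξ y))) (volume.prod volume) := by
    refine ((integrable_gaussian hε).mul_prod hi.abs).mono' ?_ (Eventually.of_forall fun p => ?_)
    · refine AEStronglyMeasurable.mul (by fun_prop)
        (hi.aestronglyMeasurable.comp_snd.mul (by fun_prop))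
    · rw [Function.uncurry, norm_eq_abs, abs_mul, abs_mul, abs_of_nonneg (exp_nonneg _)]
      gcongr
      exact mul_le_of_le_one_right (abs_nonneg _) (abs_cos_le_one _)
  have e1 : ∀ y : V, rexp (-ε * ‖y‖ ^ 2) * ∫ ξ, f ξ * cos (inner ℝ ξ y) =
      ∫ ξ, rexp (-ε * ‖y‖ ^ 2) * (f ξ * cos (inner ℝ ξ y)) := fun y => (integral_const_mul _ _).symm
  simp only [e1]
  rw [integral_integral_swap hint]
  have e2 : ∀ ξ : V, ∫ y : V, rexp (-ε * ‖y‖ ^ 2) * (f ξ * cos (inner ℝ ξ y)) =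
      f ξ * ((π / ε) ^ (Module.finrank ℝ V / 2 : ℝ) * rexp (-(1 / (4 * ε)) * ‖ξ‖ ^ 2)) := by
    intro ξ
    rw [← integral_gaussian_mul_cos hε, ← integral_const_mul]
    simp only [real_inner_comm, mul_left_comm]
  simp only [e2]
  have hg := (integrable_gaussian (V := V) (b := 1 / (4 * ε)) (by positivity)).const_mul
    ((π / ε) ^ (Module.finrank ℝ V / 2 : ℝ))
  calc _ ≤ ∫ ξ : V, B * ((π / ε) ^ (Module.finrank ℝ V / 2 : ℝ) *
          rexp (-(1 / (4 * ε)) * ‖ξ‖ ^ 2)) := by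
        refine integral_mono (hi.mul_bdd (c := (π / ε) ^ (Module.finrank ℝ V / 2 : ℝ))
          hg.aestronglyMeasurable (Eventually.of_forall fun ξ => ?_)) (hg.const_mul B) fun ξ => ?_
        · rw [norm_eq_abs, abs_of_nonneg (by positivity)]
          refine mul_le_of_le_one_right (by positivity) (exp_le_one_iff.2 ?_)
          have : 0 ≤ 1 / (4 * ε) * ‖ξ‖ ^ 2 := by positivity
          linarith
        · exact mul_le_mul_of_nonneg_right (hB ξ) (by positivity)
    _ = _ := by
        rw [integral_const_mul, integral_const_mul,
          GaussianFourier.integral_rexp_neg_mul_sq_norm (by positivity),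
          ← mul_rpow (by positivity) (by positivity)]
        have : π / ε * (π / (1 / (4 * ε))) = (2 * π) ^ (2 : ℝ) := by
          rw [rpow_two]; field_simp; ring
        rw [this, ← rpow_mul (by positivity), mul_div_cancel₀ _ two_ne_zero, rpow_natCast]

/-- The transform is nonnegative, so Fatou removes the Gaussian cutoff. -/
theorem lintegral_cosTransform_le {f : V → ℝ} (hf : PosMultiplier f) (hi : Integrable f) {B : ℝ}
    (hB : ∀ ξ, f ξ ≤ B) :
    ∫⁻ y : V, ENNReal.ofReal (∫ ξ, f ξ * cos (inner ℝ ξ y)) ≤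
      ENNReal.ofReal (B * (2 * π) ^ Module.finrank ℝ V) := by
  have hn : ∀ n : ℕ, (0 : ℝ) < 1 / ((n : ℝ) + 1) := fun n => by positivity
  set h : V → ℝ := fun y => ∫ ξ, f ξ * cos (inner ℝ ξ y) with hh
  have h0 : ∀ y, 0 ≤ h y := hf.cosTransform_nonneg hi
  have hm : Measurable h := by
    have : Measurable (Function.uncurry fun y ξ : V => f ξ * cos (inner ℝ ξ y)) :=
      (hf.measurable.comp measurable_snd).mul (by fun_prop)
    exact (StronglyMeasurable.integral_prod_right (ν := volume) this.stronglyMeasurable).measurable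
  have hb : ∀ y, |h y| ≤ ∫ ξ, |f ξ| := fun y => by
    rw [← norm_eq_abs]
    refine norm_integral_le_of_norm_le hi.abs (Eventually.of_forall fun ξ => ?_)
    rw [norm_eq_abs, abs_mul]
    exact mul_le_of_le_one_right (abs_nonneg _) (abs_cos_le_one _)
  have key : ∀ n : ℕ, ∫⁻ y : V, ENNReal.ofReal (rexp (-(1 / ((n : ℝ) + 1)) * ‖y‖ ^ 2) * h y) ≤
      ENNReal.ofReal (B * (2 * π) ^ Module.finrank ℝ V) := fun n => by
    rw [← ofReal_integral_eq_lintegral_ofReal]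
    · exact ENNReal.ofReal_le_ofReal (integral_gaussian_mul_cosTransform_le hi hB (hn n))
    · exact (integrable_gaussian (hn n)).mul_bdd hm.aestronglyMeasurable (Eventually.of_forall hb)
    · exact Eventually.of_forall fun y => mul_nonneg (exp_nonneg _) (h0 y)
  calc ∫⁻ y : V, ENNReal.ofReal (h y) = ∫⁻ y : V, liminf (fun n : ℕ =>
        ENNReal.ofReal (rexp (-(1 / ((n : ℝ) + 1)) * ‖y‖ ^ 2) * h y)) atTop := by
        refine lintegral_congr fun y => ?_
        refine (Tendsto.liminf_eq ?_).symm
        have := (tendsto_gaussian_one y).mul_const (h y)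
        rw [one_mul] at this
        exact (ENNReal.continuous_ofReal.tendsto _).comp this
    _ ≤ liminf (fun n : ℕ => ∫⁻ y : V,
        ENNReal.ofReal (rexp (-(1 / ((n : ℝ) + 1)) * ‖y‖ ^ 2) * h y)) atTop :=
        lintegral_liminf_le fun n => by fun_prop
    _ ≤ _ := by
        refine (liminf_le_liminf (Eventually.of_forall key)).trans ?_
        simp

theorem integrable_exp_neg_mul_norm {a : ℝ} (ha : 0 < a) :
    Integrable fun v : V => rexp (-(a * ‖v‖)) := by
  set m := Module.finrank ℝ V + 1 with hm
  have h := (integrable_one_add_norm (E := V) (μ := volume) (r := (m : ℝ))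
    (by rw [hm]; push_cast; linarith)).const_mul (rexp a * (m.factorial : ℝ) / a ^ m)
  refine h.mono' (by fun_prop) (Eventually.of_forall fun v => ?_)
  have h1 : 0 < 1 + ‖v‖ := by positivity
  rw [norm_eq_abs, abs_of_nonneg (exp_nonneg _), rpow_neg h1.le, rpow_natCast]
  have h2 := pow_div_factorial_le_exp (a * (1 + ‖v‖)) (by positivity) m
  rw [mul_add, mul_one, Real.exp_add] at h2
  rw [Real.exp_neg, ← div_eq_mul_inv, inv_eq_one_div, div_div, div_le_div_iff₀ (exp_pos _) (by positivity)]
  rw [div_le_iff₀ (by positivity), ← mul_one_add, mul_pow] at h2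
  linarith

end CosTransform

/-- For finite `q`, integrate `|f|^q ≤ M^(q-1) |f|`. -/
theorem eLpNorm_le_of_norm_le_of_lintegral_le_one {α E : Type*} [MeasurableSpace α]
    [NormedAddCommGroup E] {μ : Measure α} {f : α → E} {M : ℝ} (hM : 0 < M) (hf : ∀ z, ‖f z‖ ≤ M)
    (h1 : ∫⁻ z, ‖f z‖ₑ ∂μ ≤ 1) {q : ℝ≥0∞} (hq : 1 ≤ q) :
    eLpNorm f q μ ≤ ENNReal.ofReal (M ^ (1 - (1 / q).toReal)) := by
  rcases eq_or_ne q ⊤ with rfl | hq'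
  · simpa using eLpNormEssSup_le_of_ae_bound (Eventually.of_forall hf)
  have hq0 : q ≠ 0 := (zero_lt_one.trans_le hq).ne'
  set p := q.toReal with hp
  have hp1 : 1 ≤ p := by simpa using ENNReal.toReal_mono hq' hq
  rw [eLpNorm_eq_lintegral_rpow_enorm_toReal hq0 hq', one_div q, ENNReal.toReal_inv, ← hp]
  have hle : ∫⁻ z, ‖f z‖ₑ ^ p ∂μ ≤ ENNReal.ofReal M ^ (p - 1) := by
    calc ∫⁻ z, ‖f z‖ₑ ^ p ∂μ ≤ ∫⁻ z, ENNReal.ofReal M ^ (p - 1) * ‖f z‖ₑ ∂μ := by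
          refine lintegral_mono fun z => ?_
          have : ‖f z‖ₑ ^ p = ‖f z‖ₑ ^ (p - 1) * ‖f z‖ₑ := by
            conv_rhs => rw [← ENNReal.rpow_one ‖f z‖ₑ, ← ENNReal.rpow_mul, one_mul,
              ← ENNReal.rpow_add_of_nonneg _ _ (by linarith) zero_le_one, sub_add_cancel]
          rw [this]
          have hz : ‖f z‖ₑ ≤ ENNReal.ofReal M := by
            rw [← ofReal_norm]
            exact ENNReal.ofReal_le_ofReal (hf z)
          gcongr
      _ = ENNReal.ofReal M ^ (p - 1) * ∫⁻ z, ‖f z‖ₑ ∂μ :=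
          lintegral_const_mul' _ _ (by simp [hM, ENNReal.rpow_eq_top_iff])
      _ ≤ _ := mul_le_of_le_one_right' h1
  calc (∫⁻ z, ‖f z‖ₑ ^ p ∂μ) ^ (1 / p) ≤ (ENNReal.ofReal M ^ (p - 1)) ^ (1 / p) := by gcongr
    _ = _ := by
      rw [← ENNReal.rpow_mul, ENNReal.ofReal_rpow_of_pos hM]
      congr 2
      field_simp

/-! ### The modulus of the integrand: factorization, bounds, scaling. -/

section Weight

/-- The modulus of the integrand of the Grushin heat kernel. -/
noncomputable def kernelWeight (N : ℕ) {V : Type*} [NormedAddCommGroup V]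
    (x x₀ : EuclideanSpace ℝ (Fin N)) (t : ℝ) (ξ : V) : ℝ :=
  (‖ξ‖ / sinh (‖ξ‖ * t)) ^ ((N : ℝ) / 2) *
    rexp (-(‖ξ‖ / 2 * ((‖x‖ ^ 2 + ‖x₀‖ ^ 2) * (cosh (‖ξ‖ * t) / sinh (‖ξ‖ * t)) -
      2 * inner ℝ x x₀ * (1 / sinh (‖ξ‖ * t)))))

theorem one_le_mul_coth {u : ℝ} (hu : u ≠ 0) : 1 ≤ u * (cosh u / sinh u) := by
  rw [← sub_nonneg]
  refine ge_of_tendsto' (tendsto_sum_coth hu) fun n => Finset.sum_nonneg fun j _ => ?_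
  refine mul_nonneg zero_le_two (sub_nonneg.2 ?_)
  rw [div_le_one (by positivity)]
  linarith [show 0 ≤ u ^ 2 / (π * ((j : ℝ) + 1)) ^ 2 by positivity]

theorem div_sinh_le_two_mul_exp {r : ℝ} (hr : 0 ≤ r) : r / sinh r ≤ 2 * rexp (-(r / 2)) := by
  have h1 := div_sinh_le_one (u := r / 2) (by positivity)
  have h0 := div_sinh_nonneg (r / 2)
  have hc := cosh_pos (r / 2)
  have e : r / sinh r = r / 2 / sinh (r / 2) * (1 / cosh (r / 2)) := by
    conv_lhs => rw [show r = 2 * (r / 2) by ring, sinh_two_mul]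
    rw [mul_assoc, mul_div_mul_left _ _ two_ne_zero, div_mul_div_comm, mul_one]
  rw [e]
  refine (mul_le_of_le_one_left (by positivity) h1).trans ?_
  rw [div_le_iff₀ hc, cosh_eq]
  have : rexp (-(r / 2)) * rexp (r / 2) = 1 := by rw [← Real.exp_add]; simp
  nlinarith [exp_pos (-(r / 2))]

variable {N : ℕ} {V : Type*} [NormedAddCommGroup V] (x x₀ : EuclideanSpace ℝ (Fin N))

theorem kernelWeight_eq {t : ℝ} (ht : 0 < t) (ξ : V) :
    kernelWeight N x x₀ t ξ = (‖ξ‖ / sinh (‖ξ‖ * t)) ^ ((N : ℝ) / 2) *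
      (rexp (-(‖x - x₀‖ ^ 2 / 4 * (‖ξ‖ * (cosh (‖ξ‖ * (t / 2)) / sinh (‖ξ‖ * (t / 2)))))) *
       rexp (-(‖x + x₀‖ ^ 2 / 4 * (‖ξ‖ * (sinh (‖ξ‖ * (t / 2)) / cosh (‖ξ‖ * (t / 2))))))) := by
  rw [kernelWeight, ← Real.exp_add]
  rcases eq_or_ne ‖ξ‖ 0 with h | h
  · simp [h]
  congr 2
  have hu : ‖ξ‖ * (t / 2) ≠ 0 := by positivity
  have e : ‖ξ‖ * t = 2 * (‖ξ‖ * (t / 2)) := by ring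
  rw [e]
  have hs := sinh_ne_zero.2 hu
  have hc := (cosh_pos (‖ξ‖ * (t / 2))).ne'
  have hcs := cosh_sq (‖ξ‖ * (t / 2))
  rw [sinh_two_mul, cosh_two_mul, norm_sub_sq_real, norm_add_sq_real]
  generalize sinh (‖ξ‖ * (t / 2)) = S at *
  generalize cosh (‖ξ‖ * (t / 2)) = C at *
  field_simp
  linear_combination (-8 * inner ℝ x x₀ : ℝ) * hcs

theorem kernelWeight_nonneg {t : ℝ} (ht : 0 < t) (ξ : V) : 0 ≤ kernelWeight N x x₀ t ξ := by
  have : 0 ≤ ‖ξ‖ / sinh (‖ξ‖ * t) := div_nonneg (norm_nonneg _) (sinh_nonneg_iff.2 (by positivity))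
  unfold kernelWeight
  positivity

theorem div_sinh_mul_eq {t : ℝ} (ht : 0 < t) (r : ℝ) :
    r / sinh (r * t) = t⁻¹ * (r * t / sinh (r * t)) := by
  field_simp

theorem kernelWeight_le_div_sinh {t : ℝ} (ht : 0 < t) (ξ : V) :
    kernelWeight N x x₀ t ξ ≤ (‖ξ‖ / sinh (‖ξ‖ * t)) ^ ((N : ℝ) / 2) := by
  have h0 : 0 ≤ sinh (‖ξ‖ * (t / 2)) := sinh_nonneg_iff.2 (by positivity)
  have h1 : 0 ≤ ‖ξ‖ / sinh (‖ξ‖ * t) := div_nonneg (norm_nonneg _) (sinh_nonneg_iff.2 (by positivity))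
  have h2 := cosh_pos (‖ξ‖ * (t / 2))
  rw [kernelWeight_eq x x₀ ht]
  refine mul_le_of_le_one_right (by positivity) (mul_le_one₀ ?_ (exp_nonneg _) ?_) <;>
  · rw [exp_le_one_iff, neg_nonpos]
    positivity

/-- The bound is the limit of the weight as `ξ → 0`; it follows from `u / sinh u ≤ 1` and from `u
coth u ≥ 1` at `u = |ξ|t/2`. -/
theorem kernelWeight_le_gaussian (hN : 1 ≤ N) {t : ℝ} (ht : 0 < t) (ξ : V) :
    kernelWeight N x x₀ t ξ ≤
      (t⁻¹) ^ ((N : ℝ) / 2) * rexp (-(1 / (2 * t)) * ‖x - x₀‖ ^ 2) := by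
  have hN' : (0 : ℝ) < N / 2 := by positivity
  rcases eq_or_ne ‖ξ‖ 0 with h | h
  · rw [kernelWeight, h, zero_div, zero_rpow hN'.ne', zero_mul]
    positivity
  have h0 : 0 ≤ sinh (‖ξ‖ * (t / 2)) := sinh_nonneg_iff.2 (by positivity)
  have h2 := cosh_pos (‖ξ‖ * (t / 2))
  have h3 := div_sinh_nonneg (‖ξ‖ * t)
  rw [kernelWeight_eq x x₀ ht, div_sinh_mul_eq ht]
  refine mul_le_mul ?_ ?_ (by positivity) (by positivity)
  · refine rpow_le_rpow (by positivity) ?_ hN'.le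
    exact mul_le_of_le_one_right (by positivity) (div_sinh_le_one (by positivity))
  · refine (mul_le_of_le_one_right (exp_nonneg _) ?_).trans (exp_le_exp.2 ?_)
    · rw [exp_le_one_iff, neg_nonpos]
      positivity
    · have hu : ‖ξ‖ * (t / 2) ≠ 0 := by positivity
      have h4 := mul_le_mul_of_nonneg_left (one_le_mul_coth hu)
        (show 0 ≤ ‖x - x₀‖ ^ 2 / (2 * t) by positivity)
      have e1 : ‖x - x₀‖ ^ 2 / (2 * t) *
          (‖ξ‖ * (t / 2) * (cosh (‖ξ‖ * (t / 2)) / sinh (‖ξ‖ * (t / 2)))) =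
          ‖x - x₀‖ ^ 2 / 4 * (‖ξ‖ * (cosh (‖ξ‖ * (t / 2)) / sinh (‖ξ‖ * (t / 2)))) := by
        generalize cosh (‖ξ‖ * (t / 2)) / sinh (‖ξ‖ * (t / 2)) = D
        field_simp
        ring
      rw [e1] at h4
      have e2 : -(1 / (2 * t)) * ‖x - x₀‖ ^ 2 = -(‖x - x₀‖ ^ 2 / (2 * t) * 1) := by ring
      rw [e2]
      exact neg_le_neg h4

theorem div_sinh_rpow_eq_smul {E : Type*} [NormedAddCommGroup E] [NormedSpace ℝ E] {t a : ℝ} (ht : 0 < t) (ξ : E) :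
    (‖ξ‖ / sinh (‖ξ‖ * t)) ^ a = (t⁻¹) ^ a * (‖t • ξ‖ / sinh ‖t • ξ‖) ^ a := by
  rw [div_sinh_mul_eq ht, mul_rpow (by positivity) (div_sinh_nonneg _), norm_smul, norm_eq_abs,
    abs_of_pos ht, mul_comm t]

variable [InnerProductSpace ℝ V] [FiniteDimensional ℝ V] [MeasurableSpace V] [BorelSpace V]

theorem posMultiplier_kernelWeight [Nontrivial V] (hN : 1 ≤ N) {t : ℝ} (ht : 0 < t) :
    PosMultiplier (kernelWeight (V := V) N x x₀ t) := by
  refine PosMultiplier.congr ?_ fun ξ => kernelWeight_eq x x₀ ht ξ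
  exact (PosMultiplier.div_sinh_rpow ht (by positivity)).mul
    ((PosMultiplier.exp_neg_coth (by positivity) (by positivity)).mul
    (PosMultiplier.exp_neg_tanh (by positivity) (by positivity)))

theorem integrable_div_sinh_rpow {a : ℝ} (ha : 0 < a) :
    Integrable fun ξ : V => (‖ξ‖ / sinh ‖ξ‖) ^ a := by
  refine ((integrable_exp_neg_mul_norm (V := V) (a := a / 2) (by positivity)).const_mul
    ((2 : ℝ) ^ a)).mono' (Measurable.aestronglyMeasurable (by fun_prop))
    (Eventually.of_forall fun ξ => ?_)
  have h0 := div_sinh_nonneg ‖ξ‖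
  rw [norm_eq_abs, abs_of_nonneg (rpow_nonneg h0 _)]
  refine (rpow_le_rpow h0 (div_sinh_le_two_mul_exp (norm_nonneg ξ)) ha.le).trans_eq ?_
  rw [mul_rpow zero_le_two (exp_nonneg _), ← Real.exp_mul]
  ring_nf

theorem integrable_div_sinh_mul_rpow {t a : ℝ} (ht : 0 < t) (ha : 0 < a) :
    Integrable fun ξ : V => (‖ξ‖ / sinh (‖ξ‖ * t)) ^ a := by
  simp only [div_sinh_rpow_eq_smul ht]
  exact ((integrable_div_sinh_rpow ha).comp_smul ht.ne').const_mul _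

theorem integral_div_sinh_mul_rpow {t a : ℝ} (ht : 0 < t) :
    ∫ ξ : V, (‖ξ‖ / sinh (‖ξ‖ * t)) ^ a =
      t ^ (-(a + Module.finrank ℝ V)) * ∫ ξ : V, (‖ξ‖ / sinh ‖ξ‖) ^ a := by
  simp only [div_sinh_rpow_eq_smul ht]
  rw [integral_const_mul, Measure.integral_comp_smul_of_nonneg volume
    (fun ξ : V => (‖ξ‖ / sinh ‖ξ‖) ^ a) t (hR := ht.le), smul_eq_mul, ← mul_assoc, neg_add,
    rpow_add ht, inv_rpow ht.le, rpow_neg ht.le, rpow_neg ht.le, rpow_natCast]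

theorem integrable_kernelWeight (hN : 1 ≤ N) {t : ℝ} (ht : 0 < t) :
    Integrable (kernelWeight (V := V) N x x₀ t) := by
  have ha : (0 : ℝ) < N / 2 := by positivity
  refine (integrable_div_sinh_mul_rpow ht ha).mono'
    (Measurable.aestronglyMeasurable (by unfold kernelWeight; fun_prop))
    (Eventually.of_forall fun ξ => ?_)
  rw [norm_eq_abs, abs_of_nonneg (kernelWeight_nonneg x x₀ ht ξ)]
  exact kernelWeight_le_div_sinh x x₀ ht ξ

end Weight

/-! ### Sup and mass bounds for the heat kernel. -/

section HeatKernel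

variable {N k : ℕ} (x x₀ : EuclideanSpace ℝ (Fin N)) (y : EuclideanSpace ℝ (Fin k))

theorem kernelIntegrand_eq (t : ℝ) (ξ : EuclideanSpace ℝ (Fin k)) :
    kernelIntegrand N k x x₀ y t ξ =
      ((kernelWeight N x x₀ t ξ * cos (inner ℝ ξ y) : ℝ) : ℂ) +
        ((kernelWeight N x x₀ t ξ * sin (inner ℝ ξ y) : ℝ) : ℂ) * Complex.I := by
  rw [kernelIntegrand, kernelWeight, sub_eq_neg_add, Complex.exp_add, mul_comm Complex.I,
    Complex.exp_mul_I, ← Complex.ofReal_neg, ← Complex.ofReal_exp, ← Complex.ofReal_cos,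
    ← Complex.ofReal_sin]
  simp only [Complex.ofReal_mul]
  ring

theorem integrable_mul_sin {V : Type*} [NormedAddCommGroup V] [InnerProductSpace ℝ V]
    [FiniteDimensional ℝ V] [MeasurableSpace V] [BorelSpace V] {g : V → ℝ} (hg : Integrable g)
    (y : V) : Integrable fun ξ => g ξ * sin (inner ℝ ξ y) := by
  refine hg.mul_bdd (c := 1) (by fun_prop) (Eventually.of_forall fun ξ => ?_)
  simpa using abs_sin_le_one _

theorem integrable_kernelIntegrand (hN : 1 ≤ N) {t : ℝ} (ht : 0 < t) :
    Integrable (kernelIntegrand N k x x₀ y t) := by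
  have hw := integrable_kernelWeight (V := EuclideanSpace ℝ (Fin k)) x x₀ hN ht
  refine (Integrable.add (integrable_mul_cos hw y).ofReal
    ((integrable_mul_sin hw y).ofReal.mul_const Complex.I)).congr
    (Eventually.of_forall fun ξ => (kernelIntegrand_eq x x₀ y t ξ).symm)

theorem integral_kernelIntegrand (hN : 1 ≤ N) {t : ℝ} (ht : 0 < t) :
    ∫ ξ, kernelIntegrand N k x x₀ y t ξ =
      ((∫ ξ : EuclideanSpace ℝ (Fin k), kernelWeight N x x₀ t ξ * cos (inner ℝ ξ y) : ℝ) : ℂ) := by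
  have hw := integrable_kernelWeight (V := EuclideanSpace ℝ (Fin k)) x x₀ hN ht
  have hc : Integrable fun ξ : EuclideanSpace ℝ (Fin k) =>
    ((kernelWeight N x x₀ t ξ * cos (inner ℝ ξ y) : ℝ) : ℂ) := (integrable_mul_cos hw y).ofReal
  have hs : Integrable fun ξ : EuclideanSpace ℝ (Fin k) =>
    ((kernelWeight N x x₀ t ξ * sin (inner ℝ ξ y) : ℝ) : ℂ) := (integrable_mul_sin hw y).ofReal
  simp only [kernelIntegrand_eq]
  rw [integral_add hc (hs.mul_const Complex.I), integral_mul_const, integral_complex_ofReal,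
    integral_complex_ofReal]
  -- The weight is even in `ξ`, so the sine part integrates to zero.
  have h := integral_neg_eq_self
    (fun ξ : EuclideanSpace ℝ (Fin k) => kernelWeight N x x₀ t ξ * sin (inner ℝ ξ y)) volume
  simp only [kernelWeight, norm_neg, inner_neg_left, sin_neg, mul_neg, integral_neg] at h
  rw [show ∫ ξ : EuclideanSpace ℝ (Fin k), kernelWeight N x x₀ t ξ * sin (inner ℝ ξ y) = 0 by
    simp only [kernelWeight]; linarith]
  simp

theorem norm_heatKernel_le (hN : 1 ≤ N) {t : ℝ} (ht : 0 < t) :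
    ‖heatKernel N k x x₀ y t‖ ≤ 1 / (2 * π) ^ (((N : ℝ) + 2 * k) / 2) *
      (∫ ξ : EuclideanSpace ℝ (Fin k), (‖ξ‖ / sinh ‖ξ‖) ^ ((N : ℝ) / 2)) *
      t ^ (-(((N : ℝ) + 2 * k) / 2)) := by
  have ha : (0 : ℝ) < N / 2 := by positivity
  rw [heatKernel, integral_kernelIntegrand x x₀ y hN ht, ← Complex.ofReal_mul, Complex.norm_real,
    norm_mul, norm_of_nonneg (by positivity), mul_assoc]
  refine mul_le_mul_of_nonneg_left ?_ (by positivity)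
  have e := integral_div_sinh_mul_rpow (V := EuclideanSpace ℝ (Fin k)) (a := (N : ℝ) / 2) ht
  rw [finrank_euclideanSpace_fin, show (N : ℝ) / 2 + k = ((N : ℝ) + 2 * k) / 2 by ring,
    mul_comm] at e
  rw [← e]
  refine norm_integral_le_of_norm_le (integrable_div_sinh_mul_rpow ht ha)
    (Eventually.of_forall fun ξ => ?_)
  have h0 := kernelWeight_nonneg x x₀ ht ξ
  rw [norm_mul, norm_of_nonneg h0]
  exact (mul_le_of_le_one_right h0 (abs_cos_le_one _)).trans (kernelWeight_le_div_sinh x x₀ ht ξ)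

/-- The right side is the Euclidean heat kernel of `½Δ_x`, of mass 1 in `x`. `1 ≤ k` makes `ξ = 0` a
null set. -/
theorem lintegral_enorm_heatKernel_le (hN : 1 ≤ N) (hk : 1 ≤ k) {t : ℝ} (ht : 0 < t) :
    ∫⁻ y, ‖heatKernel N k x x₀ y t‖ₑ ≤
      ENNReal.ofReal ((2 * π * t)⁻¹ ^ ((N : ℝ) / 2) * rexp (-(1 / (2 * t)) * ‖x - x₀‖ ^ 2)) := by
  have : Nonempty (Fin k) := ⟨⟨0, hk⟩⟩
  have hc : 0 ≤ 1 / (2 * π) ^ (((N : ℝ) + 2 * k) / 2) := by positivity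
  have hP := posMultiplier_kernelWeight (V := EuclideanSpace ℝ (Fin k)) x x₀ hN ht
  have hI := integrable_kernelWeight (V := EuclideanSpace ℝ (Fin k)) x x₀ hN ht
  have e : ∀ y, ‖heatKernel N k x x₀ y t‖ₑ =
      ENNReal.ofReal (1 / (2 * π) ^ (((N : ℝ) + 2 * k) / 2)) * ENNReal.ofReal
      (∫ ξ : EuclideanSpace ℝ (Fin k), kernelWeight N x x₀ t ξ * cos (inner ℝ ξ y)) := fun y => by
    rw [heatKernel, integral_kernelIntegrand x x₀ y hN ht, ← Complex.ofReal_mul,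
      ← ofReal_norm, Complex.norm_real,
      norm_of_nonneg (mul_nonneg hc (hP.cosTransform_nonneg hI y)), ENNReal.ofReal_mul hc]
  simp only [e]
  rw [lintegral_const_mul' _ _ ENNReal.ofReal_ne_top]
  refine (mul_le_mul_right (lintegral_cosTransform_le hP hI
    (kernelWeight_le_gaussian x x₀ hN ht)) _).trans_eq ?_
  have e1 : (2 * π * t)⁻¹ ^ ((N : ℝ) / 2) =
      ((2 * π) ^ ((N : ℝ) / 2))⁻¹ * t⁻¹ ^ ((N : ℝ) / 2) := by
    rw [mul_inv (2 * π) t, mul_rpow (by positivity) (by positivity),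
      inv_rpow (x := 2 * π) (by positivity)]
  have e2 : (2 * π) ^ (((N : ℝ) + 2 * k) / 2) = (2 * π) ^ ((N : ℝ) / 2) * (2 * π) ^ k := by
    rw [add_div, rpow_add (by positivity), mul_div_cancel_left₀ _ two_ne_zero, rpow_natCast]
  have hA : (2 * π) ^ ((N : ℝ) / 2) ≠ 0 := by positivity
  have hB : (2 * π) ^ k ≠ 0 := by positivity
  rw [← ENNReal.ofReal_mul hc, finrank_euclideanSpace_fin, e1, e2]
  generalize (2 * π) ^ ((N : ℝ) / 2) = A at *
  generalize (2 * π) ^ k = B at *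
  congr 1
  generalize t⁻¹ ^ ((N : ℝ) / 2) = T
  field_simp

theorem lintegral_prod_enorm_heatKernel_le_one (hN : 1 ≤ N) (hk : 1 ≤ k) {t : ℝ} (ht : 0 < t)
    (hm : AEMeasurable fun z : EuclideanSpace ℝ (Fin N) × EuclideanSpace ℝ (Fin k) =>
      ‖heatKernel N k z.1 x₀ z.2 t‖ₑ) :
    ∫⁻ z : EuclideanSpace ℝ (Fin N) × EuclideanSpace ℝ (Fin k),
      ‖heatKernel N k z.1 x₀ z.2 t‖ₑ ≤ 1 := by
  rw [Measure.volume_eq_prod] at hm ⊢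
  rw [lintegral_prod _ hm]
  refine (lintegral_mono fun x => lintegral_enorm_heatKernel_le x x₀ hN hk ht).trans_eq ?_
  have hb : 0 < 1 / (2 * t) := by positivity
  rw [lintegral_sub_right_eq_self (μ := volume) (fun x : EuclideanSpace ℝ (Fin N) => ENNReal.ofReal
    ((2 * π * t)⁻¹ ^ ((N : ℝ) / 2) * rexp (-(1 / (2 * t)) * ‖x‖ ^ 2))) x₀,
    ← ofReal_integral_eq_lintegral_ofReal ((integrable_gaussian hb).const_mul _)
    (Eventually.of_forall fun x => by positivity), integral_const_mul,
    GaussianFourier.integral_rexp_neg_mul_sq_norm hb, finrank_euclideanSpace_fin,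
    ← mul_rpow (by positivity) (by positivity)]
  have : (2 * π * t)⁻¹ * (π / (1 / (2 * t))) = 1 := by field_simp
  rw [this, one_rpow, ENNReal.ofReal_one]

theorem stronglyMeasurable_heatKernel (t : ℝ) :
    StronglyMeasurable fun z : EuclideanSpace ℝ (Fin N) × EuclideanSpace ℝ (Fin k) =>
      heatKernel N k z.1 x₀ z.2 t := by
  unfold heatKernel
  refine StronglyMeasurable.const_mul (StronglyMeasurable.integral_prod_right (ν := volume)
    (f := fun (z : EuclideanSpace ℝ (Fin N) × EuclideanSpace ℝ (Fin k)) ξ =>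
      kernelIntegrand N k z.1 x₀ z.2 t ξ) (Measurable.stronglyMeasurable ?_)) _
  unfold Function.uncurry kernelIntegrand
  fun_prop

end HeatKernel

end Grushin


/-! ### Interpolation between the two endpoint bounds. -/

theorem theorem2p2 (N k : ℕ) (hN : 1 ≤ N) (hk : 1 ≤ k) :
    (∀ (x x₀ : EuclideanSpace ℝ (Fin N)) (y : EuclideanSpace ℝ (Fin k)) (t : ℝ), 0 < t →
      Integrable (Grushin.kernelIntegrand N k x x₀ y t) volume) ∧
    ∀ q : ℝ≥0∞, 1 ≤ q →
      ∃ C : ℝ, 0 < C ∧ ∀ (x₀ : EuclideanSpace ℝ (Fin N)) (t : ℝ), 0 < t →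
        MemLp (fun z : EuclideanSpace ℝ (Fin N) × EuclideanSpace ℝ (Fin k) =>
          Grushin.heatKernel N k z.1 x₀ z.2 t) q volume ∧
        eLpNorm (fun z : EuclideanSpace ℝ (Fin N) × EuclideanSpace ℝ (Fin k) =>
          Grushin.heatKernel N k z.1 x₀ z.2 t) q volume ≤
          ENNReal.ofReal
            (C * t ^ (-(((N : ℝ) + 2 * (k : ℝ)) / 2 * (1 - (1 / q).toReal)))) := by
  refine ⟨fun x x₀ y t ht => Grushin.integrable_kernelIntegrand x x₀ y hN ht, fun q hq => ?_⟩
  set d : ℝ := ((N : ℝ) + 2 * (k : ℝ)) / 2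
  set A : ℝ := 1 / (2 * Real.pi) ^ d *
    ∫ ξ : EuclideanSpace ℝ (Fin k), (‖ξ‖ / Real.sinh ‖ξ‖) ^ ((N : ℝ) / 2) with hA
  have hA0 : 0 ≤ A := mul_nonneg (by positivity)
    (integral_nonneg fun ξ => Real.rpow_nonneg (Grushin.div_sinh_nonneg _) _)
  -- `A + 1` gives a positive constant without proving `A > 0`.
  refine ⟨(A + 1) ^ (1 - (1 / q).toReal), by positivity, fun x₀ t ht => ?_⟩
  have hm := Grushin.stronglyMeasurable_heatKernel (N := N) (k := k) x₀ t
  have hb : ∀ z : EuclideanSpace ℝ (Fin N) × EuclideanSpace ℝ (Fin k),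
      ‖Grushin.heatKernel N k z.1 x₀ z.2 t‖ ≤ (A + 1) * t ^ (-d) := fun z =>
    (Grushin.norm_heatKernel_le z.1 x₀ z.2 hN ht).trans
      (mul_le_mul_of_nonneg_right (by linarith) (by positivity))
  have hle := Grushin.eLpNorm_le_of_norm_le_of_lintegral_le_one (by positivity) hb
    (Grushin.lintegral_prod_enorm_heatKernel_le_one x₀ hN hk ht hm.enorm.aemeasurable) hq
  rw [Real.mul_rpow (by positivity) (by positivity), ← Real.rpow_mul ht.le, neg_mul] at hle
  exact ⟨⟨hm.aestronglyMeasurable, hle.trans_lt ENNReal.ofReal_lt_top⟩, hle⟩
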